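/- Let $d\in\mathbb N$ and $T>0$, and let $\mathcal P$ be the set of Borel probability measures on $\mathbb R^d$ with the topology of weak convergence. Let $a_{ij},b_i:[0,T]\times\mathbb R^d\to\mathbb R$ $(1\le i,j\le d)$ be Borel measurable, globally bounded, and continuous in $x\in\mathbb R^d$ for each fixed $t\in[0,T]$, and let the matrix $(a_{ij}(t,x))_{i,j}$ be symmetric and non-negative definite for all $(t,x)\in[0,T]\times\mathbb R^d$. For smooth $f:\mathbb R^d\to\mathbb R$ put $$L_tf(x)=\tfrac12\sum_{i,j}a_{ij}(t,x)\,\partial_i\partial_jf(x)+\sum_i b_i(t,x)\,\partial_if(x).$$ For $(s,\nu)\in[0,T]\times\mathcal P$ let $FP(s,\nu)$ be the set of narrowly continuous probability solutions of the Fokker–Planck–Kolmogorov equation $\partial_t\mu_t=L_t^*\mu_t$, $\mu_s=\nu$, on $[s,T]$, i.e. of all families $(\mu_t)_{t\in[s,T]}$ in $\mathcal P$ such that $t\mapsto\mu_t(B)$ is Borel measurable for each Borel set $B\subseteq\mathbb R^d$, $t\mapsto\mu_t$ is continuous from $[s,T]$ to $\mathcal P$, $\mu_s=\nu$, and $$\int_{\mathbb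 R^d}f\,d\mu_t-\int_{\mathbb R^d}f\,d\nu=\int_s^t\int_{\mathbb R^d}L_uf(x)\,d\mu_u(x)\,du$$ for all $f\in C_0^\infty(\mathbb R^d)$ (smooth with compact support) and all $t\in[s,T]$. Suppose that $FP(s,\nu)\neq\emptyset$ for every $(s,\nu)\in[0,T]\times\mathcal P$. Then one can select $\mu^{s,\nu}=(\mu^{s,\nu}_t)_{t\in[s,T]}\in FP(s,\nu)$ for every $(s,\nu)\in[0,T]\times\mathcal P$ such that the family $(\mu^{s,\nu})$ has the flow property: $$\mu^{s,\nu}_t=\mu^{r,\mu^{s,\nu}_r}_t\qquad\text{for all }0\le s\le r\le t\le T\text{ and all }\nu\in\mathcal P.$$ -/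

import Mathlib

open MeasureTheory Set
open scoped ContDiff

namespace FPK

/-- The state space `ℝ^d` with its Euclidean norm and its Borel sigma-algebra. -/
abbrev Space (d : ℕ) : Type := EuclideanSpace ℝ (Fin d)

/-- The partial derivative `∂ᵢ f` in the `i`-th Euclidean direction. -/
noncomputable def partialDeriv {d : ℕ} (i : Fin d) (f : Space d → ℝ) (x : Space d) : ℝ :=
  fderiv ℝ f x (EuclideanSpace.single i 1)

/-- The Kolmogorov operator
`L_t f (x) = 1/2 ∑ᵢⱼ aᵢⱼ(t,x) ∂ᵢ∂ⱼ f(x) + ∑ᵢ bᵢ(t,x) ∂ᵢ f(x)`. -/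
noncomputable def generator {d : ℕ} (a : ℝ → Space d → Matrix (Fin d) (Fin d) ℝ)
    (b : ℝ → Space d → Fin d → ℝ) (t : ℝ) (f : Space d → ℝ) (x : Space d) : ℝ :=
  (1 / 2 : ℝ) * (∑ i, ∑ j, a t x i j * partialDeriv i (partialDeriv j f) x)
    + ∑ i, b t x i * partialDeriv i f x

/-- The standing assumptions on the coefficients on `[0,T] × ℝ^d`. The coefficients are written as
functions on `ℝ × ℝ^d`, but only their restriction to `[0,T] × ℝ^d` is ever constrained or used. -/
structure AdmissibleCoefficients {d : ℕ} (T : ℝ) (a : ℝ → Space d → Matrix (Fin d) (Fin d) ℝ)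
    (b : ℝ → Space d → Fin d → ℝ) : Prop where
  measurable_a : ∀ i j, Measurable fun p : Icc (0 : ℝ) T × Space d => a p.1 p.2 i j
  measurable_b : ∀ i, Measurable fun p : Icc (0 : ℝ) T × Space d => b p.1 p.2 i
  continuous_a : ∀ t ∈ Icc (0 : ℝ) T, ∀ i j, Continuous fun x => a t x i j
  continuous_b : ∀ t ∈ Icc (0 : ℝ) T, ∀ i, Continuous fun x => b t x i
  bounded_a : ∃ C : ℝ, ∀ t ∈ Icc (0 : ℝ) T, ∀ x i j, |a t x i j| ≤ C
  bounded_b : ∃ C : ℝ, ∀ t ∈ Icc (0 : ℝ) T, ∀ x i, |b t x i| ≤ C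
  /-- Each `(aᵢⱼ(t,x))` is symmetric and non-negative definite. -/
  posSemidef : ∀ t ∈ Icc (0 : ℝ) T, ∀ x, (a t x).PosSemidef

/-- `μ` is a narrowly continuous probability solution on `[s,T]` of the Cauchy problem for the
Fokker-Planck-Kolmogorov equation with initial condition `(s, ν)`. The topology on
`ProbabilityMeasure` is that of weak convergence. A curve is written as a function on `ℝ`, but only
its values on `[s,T]` are constrained. -/
structure IsSolution {d : ℕ} (T : ℝ) (a : ℝ → Space d → Matrix (Fin d) (Fin d) ℝ)
    (b : ℝ → Space d → Fin d → ℝ) (s : ℝ) (ν : ProbabilityMeasure (Space d))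
    (μ : ℝ → ProbabilityMeasure (Space d)) : Prop where
  borel_curve : ∀ B : Set (Space d), MeasurableSet B →
    Measurable fun t : Icc s T => (μ t : Measure (Space d)) B
  narrowly_continuous : ContinuousOn μ (Icc s T)
  initial : μ s = ν
  equation : ∀ f : Space d → ℝ, ContDiff ℝ ∞ f → HasCompactSupport f → ∀ t ∈ Icc s T,
    (∫ x, f x ∂(μ t : Measure (Space d))) - ∫ x, f x ∂(ν : Measure (Space d))
      = ∫ u in s..t, ∫ x, generator a b u f x ∂(μ u : Measure (Space d))

/-- The set `FP(s, ν)` of narrowly continuous probability solutions started in `(s, ν)`. -/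
def FP {d : ℕ} (T : ℝ) (a : ℝ → Space d → Matrix (Fin d) (Fin d) ℝ)
    (b : ℝ → Space d → Fin d → ℝ) (s : ℝ) (ν : ProbabilityMeasure (Space d)) :
    Set (ℝ → ProbabilityMeasure (Space d)) :=
  {μ | IsSolution T a b s ν μ}

end FPK

/-! The selection is made by a lexicographic maximization, in the spirit of Krylov's Markov
selection. For fixed `(s, ν)` the solutions, extended by the constant `ν` outside `[s,T]`, form a
compact set of curves in the product topology (`isCompact_frozenFP`). Compactness comes from
tightness (`exists_isCompact`) and from stability of the equation under limits
(`isClosed_frozenFP`), where continuity of the coefficients in `x` enters.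

Well-order all pairs of a time and a test function, once for all initial data, and let `μ s ν` be a
curve maximizing the corresponding integrals lexicographically (`IsCompact.exists_lexMax`). Since
these integrals separate curves, the maximizer is unique.

The flow property follows because solutions can be restricted (`IsSolution.restrict`) and
concatenated (`IsSolution.concat`). If the tail of `μ s ν` after `r` were not the maximizer started
at `(r, μ s ν r)`, replacing the tail by that maximizer would give a lexicographically larger
solution from `(s, ν)`. -/

open Filter Topology
open scoped ENNReal

/-! ### Lexicographic maximization on compact sets. -/

/-- On a nonempty compact set, a well-ordered family of continuous functionals has a
lexicographic maximizer. -/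
theorem IsCompact.exists_lexMax {X ι : Type*} [TopologicalSpace X] [T2Space X] [LinearOrder ι]
    [WellFoundedLT ι] {K : Set X} (hK : IsCompact K) (hne : K.Nonempty) (F : ι → X → ℝ)
    (hF : ∀ i, Continuous (F i)) :
    ∃ x ∈ K, ∀ y ∈ K, ∀ i, (∀ j < i, F j y = F j x) → F i y ≤ F i x := by
  set A : ι → Set X := fun i =>
    {x ∈ K | ∀ j ≤ i, ∀ y ∈ K, (∀ k < j, F k y = F k x) → F j y ≤ F j x} with hA
  have agree : ∀ i, ∀ x ∈ A i, ∀ y ∈ A i, ∀ j ≤ i, F j x = F j y := by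
    intro i x hx y hy j
    induction j using WellFoundedLT.induction with
    | ind j ih =>
      intro hj
      have h : ∀ k < j, F k x = F k y := fun k hk => ih k hk (hk.le.trans hj)
      exact le_antisymm (hy.2 j hj x hx.1 h) (hx.2 j hj y hy.1 fun k hk => (h k hk).symm)
  have cpt : ∀ i, (A i).Nonempty → IsCompact (A i) := by
    rintro i ⟨m, hm⟩
    -- By `agree`, `A i` is the joint level set through any one of its points, hence closed in `K`.
    have : A i = K ∩ ⋂ j : Iic i, {x | F j x = F j m} := by
      ext x
      simp only [mem_inter_iff, mem_iInter, mem_ofPred_eq, Subtype.forall, mem_Iic]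
      refine ⟨fun hx => ⟨hx.1, fun j hj => agree i x hx m hm j hj⟩, fun hx => ⟨hx.1, ?_⟩⟩
      intro j hj y hy h
      rw [hx.2 j hj]
      exact hm.2 j hj y hy fun k hk => (h k hk).trans (hx.2 k (hk.le.trans hj))
    rw [this]
    exact hK.inter_right (isClosed_iInter fun j => isClosed_eq (hF j) continuous_const)
  have anti : ∀ i j, i ≤ j → A j ⊆ A i := fun i j hij x hx =>
    ⟨hx.1, fun k hk => hx.2 k (hk.trans hij)⟩
  have inter : ∀ S : Set ι, (∀ j ∈ S, (A j).Nonempty) → ∃ x ∈ K, ∀ j ∈ S, x ∈ A j := by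
    intro S hS
    rcases S.eq_empty_or_nonempty with rfl | ⟨i₀, hi₀⟩
    · exact ⟨hne.some, hne.some_mem, by simp⟩
    · have : Nonempty S := ⟨⟨i₀, hi₀⟩⟩
      obtain ⟨x, hx⟩ := IsCompact.nonempty_iInter_of_directed_nonempty_isCompact_isClosed
        (fun j : S => A j)
        (directed_of_isDirected_le fun i j hij => anti i j hij)
        (fun j => hS j j.2) (fun j => cpt j (hS j j.2)) (fun j => (cpt j (hS j j.2)).isClosed)
      rw [mem_iInter] at hx
      exact ⟨x, (hx ⟨i₀, hi₀⟩).1, fun j hj => hx ⟨j, hj⟩⟩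
  -- Transfinite induction; `inter` applied to `Iio i` treats successor and limit stages together.
  -- Then `F i` is maximized over the points matching `x₀` below `i`.
  have nonempty : ∀ i, (A i).Nonempty := by
    intro i
    induction i using WellFoundedLT.induction with
    | ind i ih =>
      obtain ⟨x₀, hx₀K, hx₀⟩ := inter (Iio i) ih
      have hc : IsCompact (K ∩ ⋂ j : Iio i, {x | F j x = F j x₀}) :=
        hK.inter_right (isClosed_iInter fun j => isClosed_eq (hF j) continuous_const)
      obtain ⟨m, hm, hmax⟩ := hc.exists_isMaxOn ⟨x₀, hx₀K, by simp⟩ (hF i).continuousOn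
      simp only [mem_inter_iff, mem_iInter, mem_ofPred_eq, Subtype.forall, mem_Iio] at hm
      refine ⟨m, hm.1, fun j hj y hy h => ?_⟩
      rcases hj.lt_or_eq with hj | rfl
      · rw [hm.2 j hj]
        exact (hx₀ j hj).2 j le_rfl y hy fun k hk => (h k hk).trans (hm.2 k (hk.trans hj))
      · refine hmax ?_
        simp only [mem_inter_iff, mem_iInter, mem_ofPred_eq, Subtype.forall, mem_Iio]
        exact ⟨hy, fun k hk => (h k hk).trans (hm.2 k hk)⟩
  obtain ⟨x, hxK, hx⟩ := inter univ fun j _ => nonempty j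
  exact ⟨x, hxK, fun y hy i h => (hx i trivial).2 i le_rfl y hy h⟩

/-! ### Test functions and narrow convergence. -/

/-- Two finite measures on a finite-dimensional space with the same integrals of smooth compactly
supported functions coincide. -/
theorem MeasureTheory.Measure.ext_of_integral_contDiff {E : Type*} [NormedAddCommGroup E]
    [NormedSpace ℝ E] [FiniteDimensional ℝ E] [MeasurableSpace E] [BorelSpace E]
    {μ ν : Measure E} [IsFiniteMeasure μ] [IsFiniteMeasure ν]
    (h : ∀ f : E → ℝ, ContDiff ℝ ∞ f → HasCompactSupport f → ∫ x, f x ∂μ = ∫ x, f x ∂ν) :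
    μ = ν := by
  -- Passing to densities with respect to `μ + ν` reduces the claim to the fundamental lemma of the
  -- calculus of variations.
  obtain ⟨ρ, hρ, hμ, hν⟩ : ∃ ρ : Measure E, IsFiniteMeasure ρ ∧ μ ≪ ρ ∧ ν ≪ ρ :=
    ⟨μ + ν, inferInstance, Measure.AbsolutelyContinuous.rfl.add_right ν,
      add_comm ν μ ▸ Measure.AbsolutelyContinuous.rfl.add_right μ⟩
  have hdens : ∀ f : E → ℝ, ContDiff ℝ ∞ f → HasCompactSupport f →
      ∫ x, f x • (μ.rnDeriv ρ x).toReal ∂ρ = ∫ x, f x • (ν.rnDeriv ρ x).toReal ∂ρ := by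
    intro f hf hc
    simp only [smul_eq_mul, mul_comm (f _)]
    rw [integral_toReal_rnDeriv_mul hμ, integral_toReal_rnDeriv_mul hν, h f hf hc]
  have key := ae_eq_of_integral_contDiff_smul_eq
    (Measure.integrable_toReal_rnDeriv (μ := μ) (ν := ρ)).locallyIntegrable
    (Measure.integrable_toReal_rnDeriv (μ := ν) (ν := ρ)).locallyIntegrable hdens
  rw [← Measure.withDensity_rnDeriv_eq μ ρ hμ, ← Measure.withDensity_rnDeriv_eq ν ρ hν]
  refine withDensity_congr_ae ?_
  filter_upwards [key, μ.rnDeriv_lt_top ρ, ν.rnDeriv_lt_top ρ] with x hx h1 h2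
  exact (ENNReal.toReal_eq_toReal_iff' h1.ne h2.ne).1 hx

/-- Integration of a continuous compactly supported function is narrowly continuous. -/
theorem MeasureTheory.ProbabilityMeasure.continuous_integral_of_hasCompactSupport {X : Type*}
    [TopologicalSpace X] [MeasurableSpace X] [OpensMeasurableSpace X] {f : X → ℝ}
    (hf : Continuous f) (hc : HasCompactSupport f) :
    Continuous fun μ : ProbabilityMeasure X => ∫ x, f x ∂(μ : Measure X) := by
  obtain ⟨C, hC⟩ := hc.exists_bound_of_continuous hf
  exact continuous_integral_boundedContinuousFunction
    (BoundedContinuousFunction.ofNormedAddCommGroup f hf C hC)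

/-- In a compact set of probability measures, convergence of the integrals of smooth compactly
supported functions implies narrow convergence. -/
theorem IsCompact.tendsto_probabilityMeasure_of_contDiff {E : Type*} [NormedAddCommGroup E]
    [NormedSpace ℝ E] [FiniteDimensional ℝ E] [MeasurableSpace E] [BorelSpace E] {ι : Type*}
    {l : Filter ι} {K : Set (ProbabilityMeasure E)} (hK : IsCompact K)
    {m : ι → ProbabilityMeasure E} (hm : ∀ᶠ i in l, m i ∈ K) {μ : ProbabilityMeasure E}
    (h : ∀ f : E → ℝ, ContDiff ℝ ∞ f → HasCompactSupport f →
      Tendsto (fun i => ∫ x, f x ∂(m i : Measure E)) l (𝓝 (∫ x, f x ∂(μ : Measure E)))) :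
    Tendsto m l (𝓝 μ) := by
  -- Compactness rules out escape of mass, so it suffices to identify every cluster point with `μ`.
  refine hK.tendsto_nhds_of_unique_mapClusterPt hm fun ν _ hν => ?_
  suffices (ν : Measure E) = μ from Subtype.ext this
  refine Measure.ext_of_integral_contDiff fun f hf hc => ?_
  have h1 := hν.continuousAt_comp
    (ProbabilityMeasure.continuous_integral_of_hasCompactSupport hf.continuous hc).continuousAt
  have h2 := h f hf hc
  by_contra hne
  have hdis : Disjoint (𝓝 (∫ x, f x ∂(ν : Measure E))) (𝓝 (∫ x, f x ∂(μ : Measure E))) :=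
    disjoint_nhds_nhds.2 hne
  have hbot : 𝓝 (∫ x, f x ∂(ν : Measure E)) ⊓
      map (fun i => ∫ x, f x ∂(m i : Measure E)) l = ⊥ :=
    (hdis.mono_right h2).eq_bot
  exact h1.ne hbot

/-- A narrowly continuous family of probability measures is Borel measurable. -/
theorem Continuous.measurable_toMeasure {X E : Type*} [TopologicalSpace X] [MeasurableSpace X]
    [OpensMeasurableSpace X] [TopologicalSpace E] [MeasurableSpace E] [BorelSpace E]
    [HasOuterApproxClosed E] {μ : X → ProbabilityMeasure E} (hμ : Continuous μ) :
    Measurable fun t => (μ t : Measure E) := by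
  refine Measurable.measure_of_isPiSystem_of_isProbabilityMeasure
    (BorelSpace.measurable_eq.trans borel_eq_generateFrom_isClosed) isPiSystem_isClosed
    fun F (hF : IsClosed F) => ?_
  have hlim : ∀ t, Tendsto (fun n => ∫⁻ x, hF.apprSeq n x ∂(μ t : Measure E)) atTop
      (𝓝 ((μ t : Measure E) F)) := fun t =>
    HasOuterApproxClosed.tendsto_lintegral_apprSeq hF _
  refine ENNReal.measurable_of_tendsto (fun n => ?_) (tendsto_pi_nhds.2 hlim)
  exact ((ProbabilityMeasure.continuous_lintegral_boundedContinuousFunction _).comp hμ).measurable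

/-! ### Bounds and regularity of the Kolmogorov operator. -/

namespace FPK

section Generator

variable {d : ℕ} {T : ℝ} {a : ℝ → Space d → Matrix (Fin d) (Fin d) ℝ}
  {b : ℝ → Space d → Fin d → ℝ}

theorem contDiff_partialDeriv {f : Space d → ℝ} (hf : ContDiff ℝ ∞ f) (i : Fin d) :
    ContDiff ℝ ∞ (partialDeriv i f) :=
  (hf.fderiv_right (m := ∞) (by simp)).clm_apply contDiff_const

theorem hasCompactSupport_partialDeriv {f : Space d → ℝ} (hf : HasCompactSupport f) (i : Fin d) :
    HasCompactSupport (partialDeriv i f) :=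
  hf.fderiv_apply ℝ _

theorem partialDeriv_comp_smul (c : ℝ) (i : Fin d) (f : Space d → ℝ) :
    partialDeriv i (fun x => f (c • x)) = fun x => c * partialDeriv i f (c • x) := by
  ext x
  simp [partialDeriv, fderiv_comp_smul]

theorem partialDeriv_const_mul (c : ℝ) (i : Fin d) {f : Space d → ℝ} (hf : ContDiff ℝ ∞ f) :
    partialDeriv i (fun x => c * f x) = fun x => c * partialDeriv i f x := by
  ext x
  simp [partialDeriv, fderiv_const_mul (hf.differentiable (by simp) x) c]

theorem exists_bound_partialDeriv {f : Space d → ℝ} (hf : ContDiff ℝ ∞ f)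
    (hc : HasCompactSupport f) :
    ∃ M : ℝ, 0 ≤ M ∧ (∀ i x, |partialDeriv i f x| ≤ M) ∧
      ∀ i j x, |partialDeriv i (partialDeriv j f) x| ≤ M := by
  choose B hB using fun i => (hasCompactSupport_partialDeriv hc i).exists_bound_of_continuous
    (contDiff_partialDeriv hf i).continuous
  choose B' hB' using fun i j =>
    (hasCompactSupport_partialDeriv (hasCompactSupport_partialDeriv hc j) i).exists_bound_of_continuous
      (contDiff_partialDeriv (contDiff_partialDeriv hf j) i).continuous
  simp only [Real.norm_eq_abs] at hB hB'
  have p : ∀ i, 0 ≤ B i := fun i => (abs_nonneg _).trans (hB i 0)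
  have p' : ∀ i j, 0 ≤ B' i j := fun i j => (abs_nonneg _).trans (hB' i j 0)
  have s : 0 ≤ ∑ i, B i := Finset.sum_nonneg fun i _ => p i
  have s' : 0 ≤ ∑ i, ∑ j, B' i j :=
    Finset.sum_nonneg fun i _ => Finset.sum_nonneg fun j _ => p' i j
  refine ⟨∑ i, B i + ∑ i, ∑ j, B' i j, by positivity, fun i x => ?_, fun i j x => ?_⟩
  · have := Finset.single_le_sum (fun i _ => p i) (Finset.mem_univ i)
    linarith [hB i x]
  · have h1 := Finset.single_le_sum (fun j _ => p' i j) (Finset.mem_univ j)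
    have h2 := Finset.single_le_sum (f := fun i => ∑ j, B' i j)
      (fun i _ => Finset.sum_nonneg fun j _ => p' i j) (Finset.mem_univ i)
    linarith [hB' i j x]

/-- The Kolmogorov operator is bounded by the first and second derivatives of its argument. -/
theorem AdmissibleCoefficients.exists_generator_le (hab : AdmissibleCoefficients T a b) :
    ∃ C : ℝ, 0 ≤ C ∧ ∀ (f : Space d → ℝ) (δ : ℝ), 0 ≤ δ → (∀ i x, |partialDeriv i f x| ≤ δ) →
      (∀ i j x, |partialDeriv i (partialDeriv j f) x| ≤ δ) →
      ∀ t ∈ Icc (0 : ℝ) T, ∀ x, |generator a b t f x| ≤ C * δ := by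
  obtain ⟨A, hA⟩ := hab.bounded_a
  obtain ⟨B, hB⟩ := hab.bounded_b
  refine ⟨(1 / 2) * (d * (d * |A|)) + d * |B|, by positivity, fun f δ hδ h1 h2 t ht x => ?_⟩
  have e1 : |∑ i, ∑ j, a t x i j * partialDeriv i (partialDeriv j f) x| ≤ d * (d * (|A| * δ)) := by
    refine (Finset.abs_sum_le_sum_abs _ _).trans ?_
    refine (Finset.sum_le_card_nsmul _ _ (d * (|A| * δ)) fun i _ => ?_).trans_eq (by simp)
    refine (Finset.abs_sum_le_sum_abs _ _).trans ?_
    refine (Finset.sum_le_card_nsmul _ _ (|A| * δ) fun j _ => ?_).trans_eq (by simp)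
    rw [abs_mul]
    exact mul_le_mul ((hA t ht x i j).trans (le_abs_self A)) (h2 i j x) (abs_nonneg _)
      (abs_nonneg _)
  have e2 : |∑ i, b t x i * partialDeriv i f x| ≤ d * (|B| * δ) := by
    refine (Finset.abs_sum_le_sum_abs _ _).trans ?_
    refine (Finset.sum_le_card_nsmul _ _ (|B| * δ) fun i _ => ?_).trans_eq (by simp)
    rw [abs_mul]
    exact mul_le_mul ((hB t ht x i).trans (le_abs_self B)) (h1 i x) (abs_nonneg _) (abs_nonneg _)
  unfold generator
  refine (abs_add_le _ _).trans ?_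
  rw [abs_mul, abs_of_pos (by norm_num : (0 : ℝ) < 1 / 2)]
  linarith

theorem AdmissibleCoefficients.exists_bound_generator (hab : AdmissibleCoefficients T a b)
    {f : Space d → ℝ} (hf : ContDiff ℝ ∞ f) (hc : HasCompactSupport f) :
    ∃ M : ℝ, 0 ≤ M ∧ ∀ t ∈ Icc (0 : ℝ) T, ∀ x, |generator a b t f x| ≤ M := by
  obtain ⟨C, hC, h⟩ := hab.exists_generator_le
  obtain ⟨M, hM, h1, h2⟩ := exists_bound_partialDeriv hf hc
  exact ⟨C * M, by positivity, h f M hM h1 h2⟩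

theorem AdmissibleCoefficients.continuous_generator (hab : AdmissibleCoefficients T a b)
    {f : Space d → ℝ} (hf : ContDiff ℝ ∞ f) {t : ℝ} (ht : t ∈ Icc (0 : ℝ) T) :
    Continuous (generator a b t f) := by
  refine Continuous.add (continuous_const.mul ?_) ?_
  · exact continuous_finsetSum _ fun i _ => continuous_finsetSum _ fun j _ =>
      (hab.continuous_a t ht i j).mul
        (contDiff_partialDeriv (contDiff_partialDeriv hf j) i).continuous
  · exact continuous_finsetSum _ fun i _ =>
      (hab.continuous_b t ht i).mul (contDiff_partialDeriv hf i).continuous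

theorem AdmissibleCoefficients.measurable_generator (hab : AdmissibleCoefficients T a b)
    {f : Space d → ℝ} (hf : ContDiff ℝ ∞ f) :
    Measurable fun p : Icc (0 : ℝ) T × Space d => generator a b p.1 f p.2 := by
  refine Measurable.add (Measurable.const_mul ?_ _) ?_
  · exact Finset.measurable_fun_sum _ fun i _ => Finset.measurable_fun_sum _ fun j _ =>
      (hab.measurable_a i j).mul
        ((contDiff_partialDeriv (contDiff_partialDeriv hf j) i).continuous.measurable.comp
          measurable_snd)
  · exact Finset.measurable_fun_sum _ fun i _ =>
      (hab.measurable_b i).mul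
        ((contDiff_partialDeriv hf i).continuous.measurable.comp measurable_snd)

theorem AdmissibleCoefficients.integrableOn_integral_generator (hab : AdmissibleCoefficients T a b)
    {s : ℝ} (hs : s ∈ Icc (0 : ℝ) T) {μ : ℝ → ProbabilityMeasure (Space d)}
    (hμ : ContinuousOn μ (Icc s T)) {f : Space d → ℝ} (hf : ContDiff ℝ ∞ f)
    (hc : HasCompactSupport f) :
    IntegrableOn (fun u => ∫ x, generator a b u f x ∂(μ u : Measure (Space d))) (Icc s T) := by
  obtain ⟨M, hM, hbound⟩ := hab.exists_bound_generator hf hc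
  have h0T : (0 : ℝ) ≤ T := hs.1.trans hs.2
  -- Time is clamped to `[s,T]` in the curve and to `[0,T]` in the coefficients, where alone their
  -- regularity is known; both clamps are the identity on `[s,T]`.
  have hcont : Continuous fun u => μ (projIcc s T hs.2 u) :=
    (continuousOn_iff_continuous_domRestrict.1 hμ).comp continuous_projIcc
  let κ : ProbabilityTheory.Kernel ℝ (Space d) :=
    ⟨fun u => (μ (projIcc s T hs.2 u) : Measure (Space d)), hcont.measurable_toMeasure⟩
  have : ProbabilityTheory.IsMarkovKernel κ := ⟨fun u => by
    change IsProbabilityMeasure (μ (projIcc s T hs.2 u) : Measure (Space d)); infer_instance⟩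
  have hmeas : StronglyMeasurable fun u => ∫ x, generator a b (projIcc 0 T h0T u) f x ∂κ u := by
    refine StronglyMeasurable.integral_kernel_prod_right'
      (f := fun p : ℝ × Space d => generator a b (projIcc 0 T h0T p.1) f p.2) ?_
    exact ((hab.measurable_generator hf).comp
      (((continuous_projIcc (h := h0T)).measurable.comp measurable_fst).prodMk
        measurable_snd)).stronglyMeasurable
  have heq : EqOn (fun u => ∫ x, generator a b (projIcc 0 T h0T u) f x ∂κ u)
      (fun u => ∫ x, generator a b u f x ∂(μ u : Measure (Space d))) (Icc s T) := by
    intro u hu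
    change ∫ x, generator a b (projIcc 0 T h0T u) f x ∂(μ (projIcc s T hs.2 u) : Measure _) = _
    rw [projIcc_of_mem h0T ⟨hs.1.trans hu.1, hu.2⟩, projIcc_of_mem hs.2 hu]
  refine IntegrableOn.congr_fun ?_ heq measurableSet_Icc
  refine Measure.integrableOn_of_bounded (M := M) (by simp) hmeas.aestronglyMeasurable ?_
  filter_upwards with u
  refine (norm_integral_le_of_norm_le_const (C := M) ?_).trans_eq (by simp)
  filter_upwards with x using hbound _ (projIcc 0 T h0T u).2 x

theorem AdmissibleCoefficients.intervalIntegrable_integral_generator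
    (hab : AdmissibleCoefficients T a b)
    {s : ℝ} (hs : s ∈ Icc (0 : ℝ) T) {μ : ℝ → ProbabilityMeasure (Space d)}
    (hμ : ContinuousOn μ (Icc s T)) {f : Space d → ℝ} (hf : ContDiff ℝ ∞ f)
    (hc : HasCompactSupport f) {t t' : ℝ} (ht : t ∈ Icc s T) (ht' : t' ∈ Icc s T) :
    IntervalIntegrable (fun u => ∫ x, generator a b u f x ∂(μ u : Measure (Space d)))
      volume t t' :=
  ((hab.integrableOn_integral_generator hs hμ hf hc).mono_set
    (uIcc_subset_Icc ht ht')).intervalIntegrable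

theorem abs_integral_generator_le {f : Space d → ℝ} {M u : ℝ}
    (h : ∀ x, |generator a b u f x| ≤ M) (m : ProbabilityMeasure (Space d)) :
    |∫ x, generator a b u f x ∂(m : Measure (Space d))| ≤ M := by
  rw [← Real.norm_eq_abs]
  refine (norm_integral_le_of_norm_le_const (C := M) ?_).trans_eq (by simp)
  filter_upwards with x using h x

end Generator

end FPK

/-! ### Restriction, concatenation and tightness of solutions. -/

namespace FPK

section Solutions

variable {d : ℕ} {T : ℝ} {a : ℝ → Space d → Matrix (Fin d) (Fin d) ℝ}
  {b : ℝ → Space d → Fin d → ℝ}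

theorem measurable_apply_of_continuousOn {s : ℝ} {μ : ℝ → ProbabilityMeasure (Space d)}
    (hμ : ContinuousOn μ (Icc s T)) {B : Set (Space d)} (hB : MeasurableSet B) :
    Measurable fun t : Icc s T => (μ t : Measure (Space d)) B :=
  (Measure.measurable_coe hB).comp
    (continuousOn_iff_continuous_domRestrict.1 hμ).measurable_toMeasure

/-- A solution satisfies the equation between any two times. -/
theorem IsSolution.sub_eq_integral (hab : AdmissibleCoefficients T a b) {s : ℝ}
    (hs : s ∈ Icc (0 : ℝ) T) {ν : ProbabilityMeasure (Space d)}
    {μ : ℝ → ProbabilityMeasure (Space d)} (h : IsSolution T a b s ν μ) {f : Space d → ℝ}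
    (hf : ContDiff ℝ ∞ f) (hc : HasCompactSupport f) {r t : ℝ} (hr : r ∈ Icc s T)
    (ht : t ∈ Icc s T) :
    (∫ x, f x ∂(μ t : Measure (Space d))) - ∫ x, f x ∂(μ r : Measure (Space d))
      = ∫ u in r..t, ∫ x, generator a b u f x ∂(μ u : Measure (Space d)) := by
  have hss : s ∈ Icc s T := left_mem_Icc.2 hs.2
  have hi := fun {t t' : ℝ} => hab.intervalIntegrable_integral_generator
    (t := t) (t' := t') hs h.narrowly_continuous hf hc
  rw [← intervalIntegral.integral_interval_sub_left (hi hss ht) (hi hss hr),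
    ← h.equation f hf hc t ht, ← h.equation f hf hc r hr]
  ring

/-- Integrals of test functions are Lipschitz in time, with a constant which does not depend on the
solution. -/
theorem AdmissibleCoefficients.exists_lipschitz (hab : AdmissibleCoefficients T a b)
    {f : Space d → ℝ} (hf : ContDiff ℝ ∞ f) (hc : HasCompactSupport f) :
    ∃ M : ℝ, 0 ≤ M ∧ ∀ s ∈ Icc (0 : ℝ) T, ∀ ν μ, IsSolution T a b s ν μ → ∀ r ∈ Icc s T,
      ∀ t ∈ Icc s T, |(∫ x, f x ∂(μ t : Measure (Space d))) -
        ∫ x, f x ∂(μ r : Measure (Space d))| ≤ M * |t - r| := by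
  obtain ⟨M, hM, hb⟩ := hab.exists_bound_generator hf hc
  refine ⟨M, hM, fun s hs ν μ h r hr t ht => ?_⟩
  rw [h.sub_eq_integral hab hs hf hc hr ht, ← Real.norm_eq_abs]
  refine intervalIntegral.norm_integral_le_of_norm_le_const fun u hu => ?_
  have hu' := uIcc_subset_Icc hr ht (uIoc_subset_uIcc hu)
  exact abs_integral_generator_le (hb u ⟨hs.1.trans hu'.1, hu'.2⟩) _

theorem IsSolution.congr {s : ℝ} {ν : ProbabilityMeasure (Space d)}
    {μ η : ℝ → ProbabilityMeasure (Space d)} (hs : s ≤ T) (h : IsSolution T a b s ν μ)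
    (heq : EqOn η μ (Icc s T)) : IsSolution T a b s ν η where
  borel_curve _ hB := measurable_apply_of_continuousOn (h.narrowly_continuous.congr heq) hB
  narrowly_continuous := h.narrowly_continuous.congr heq
  initial := (heq (left_mem_Icc.2 hs)).trans h.initial
  equation f hf hc t ht := by
    rw [heq ht, h.equation f hf hc t ht]
    refine intervalIntegral.integral_congr fun u hu => ?_
    rw [uIcc_of_le ht.1] at hu
    simp only [heq ⟨hu.1, hu.2.trans ht.2⟩]

/-- Restriction of a solution to a later time interval. -/
theorem IsSolution.restrict (hab : AdmissibleCoefficients T a b) {s r : ℝ}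
    (hs : s ∈ Icc (0 : ℝ) T) (hr : r ∈ Icc s T) {ν : ProbabilityMeasure (Space d)}
    {μ : ℝ → ProbabilityMeasure (Space d)} (h : IsSolution T a b s ν μ) :
    IsSolution T a b r (μ r) μ where
  borel_curve _ hB :=
    measurable_apply_of_continuousOn (h.narrowly_continuous.mono (Icc_subset_Icc_left hr.1)) hB
  narrowly_continuous := h.narrowly_continuous.mono (Icc_subset_Icc_left hr.1)
  initial := rfl
  equation _ hf hc _ ht := h.sub_eq_integral hab hs hf hc hr ⟨hr.1.trans ht.1, ht.2⟩

/-- Concatenation of two solutions. -/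
theorem IsSolution.concat (hab : AdmissibleCoefficients T a b) {s r : ℝ}
    (hs : s ∈ Icc (0 : ℝ) T) (hr : r ∈ Icc s T) {ν : ProbabilityMeasure (Space d)}
    {μ η ρ : ℝ → ProbabilityMeasure (Space d)} (h : IsSolution T a b s ν μ)
    (h' : IsSolution T a b r (μ r) η) (hρμ : EqOn ρ μ (Icc s r)) (hρη : EqOn ρ η (Icc r T)) :
    IsSolution T a b s ν ρ := by
  have hcont : ContinuousOn ρ (Icc s T) := by
    rw [← Icc_union_Icc_eq_Icc hr.1 hr.2]
    exact ((h.narrowly_continuous.mono (Icc_subset_Icc_right hr.2)).congr hρμ).union_of_isClosed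
      (h'.narrowly_continuous.congr hρη) isClosed_Icc isClosed_Icc
  refine ⟨fun B hB => measurable_apply_of_continuousOn hcont hB, hcont,
    (hρμ (left_mem_Icc.2 hr.1)).trans h.initial, fun f hf hc t ht => ?_⟩
  have before : ∀ t ∈ Icc s r, (∫ x, f x ∂(ρ t : Measure (Space d))) -
      ∫ x, f x ∂(ν : Measure (Space d))
      = ∫ u in s..t, ∫ x, generator a b u f x ∂(ρ u : Measure (Space d)) := by
    intro t ht
    rw [hρμ ht, h.equation f hf hc t ⟨ht.1, ht.2.trans hr.2⟩]
    refine intervalIntegral.integral_congr fun u hu => ?_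
    rw [uIcc_of_le ht.1] at hu
    simp only [hρμ ⟨hu.1, hu.2.trans ht.2⟩]
  rcases le_total t r with htr | hrt
  · exact before t ⟨ht.1, htr⟩
  · have hrr := before r ⟨hr.1, le_rfl⟩
    have after := (h'.congr hr.2 hρη).equation f hf hc t ⟨hrt, ht.2⟩
    rw [← hρμ ⟨hr.1, le_rfl⟩] at after
    have hi := fun {t t' : ℝ} => hab.intervalIntegrable_integral_generator
      (t := t) (t' := t') hs hcont hf hc
    rw [← intervalIntegral.integral_add_adjacent_intervals (hi (left_mem_Icc.2 hs.2) hr)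
      (hi hr ht), ← hrr, ← after]
    ring

/-- All solutions with a given initial condition live in a common narrowly compact set. -/
theorem AdmissibleCoefficients.exists_isCompact (hab : AdmissibleCoefficients T a b)
    {s : ℝ} (hs : s ∈ Icc (0 : ℝ) T) (ν : ProbabilityMeasure (Space d)) :
    ∃ K : Set (ProbabilityMeasure (Space d)), IsCompact K ∧
      ∀ μ, IsSolution T a b s ν μ → ∀ t ∈ Icc s T, μ t ∈ K := by
  obtain ⟨C, hC, hgen⟩ := hab.exists_generator_le
  -- The rescaled bumps `g n` increase their support to the whole space while their derivatives,
  -- hence `generator a b t (g n)`, are of order `c n`. So the mass in large balls changes little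
  -- over `[s,T]`, uniformly over solutions.
  let χ : ContDiffBump (0 : Space d) := ⟨1, 2, by norm_num, by norm_num⟩
  have hχ : ContDiff ℝ ∞ χ := χ.contDiff
  obtain ⟨M, hM, hM1, hM2⟩ := exists_bound_partialDeriv hχ χ.hasCompactSupport
  set c : ℕ → ℝ := fun n => 1 / ((n : ℝ) + 1) with hcdef
  have hc0 : ∀ n, 0 < c n := fun n => by positivity
  have hc1 : ∀ n, c n ≤ 1 := fun n => by
    rw [hcdef]; exact (div_le_one (by positivity)).2 (by linarith [n.cast_nonneg (α := ℝ)])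
  have hclim : Tendsto c atTop (𝓝 0) := tendsto_one_div_add_atTop_nhds_zero_nat
  set g : ℕ → Space d → ℝ := fun n x => χ (c n • x)
  have g_smooth : ∀ n, ContDiff ℝ ∞ (g n) := fun n => hχ.comp (contDiff_const_smul _)
  have g_supp : ∀ n x, x ∉ Metric.closedBall (0 : Space d) (2 / c n) → g n x = 0 := by
    intro n x hx
    refine χ.zero_of_le_dist ?_
    rw [dist_zero_right, norm_smul, Real.norm_of_nonneg (hc0 n).le]
    simp only [Metric.mem_closedBall, dist_zero_right, not_le, div_lt_iff₀ (hc0 n)] at hx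
    change (2 : ℝ) ≤ _
    linarith
  have g_cpt : ∀ n, HasCompactSupport (g n) := fun n =>
    HasCompactSupport.intro (isCompact_closedBall (0 : Space d) (2 / c n)) (g_supp n)
  have g_le : ∀ n x, g n x ≤ 1 := fun n x => χ.le_one
  have g_nonneg : ∀ n x, 0 ≤ g n x := fun n x => χ.nonneg
  have g_int : ∀ n (m : ProbabilityMeasure (Space d)), Integrable (g n) (m : Measure (Space d)) :=
    fun n m => (g_smooth n).continuous.integrable_of_hasCompactSupport (g_cpt n)
  have g_gen : ∀ n, ∀ t ∈ Icc (0 : ℝ) T, ∀ x, |generator a b t (g n) x| ≤ C * (c n * M) := by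
    intro n
    have d1 : ∀ i, partialDeriv i (g n) = fun x => c n * partialDeriv i χ (c n • x) :=
      fun i => partialDeriv_comp_smul _ _ _
    refine hgen (g n) _ (mul_nonneg (hc0 n).le hM) (fun i x => ?_) (fun i j x => ?_)
    · rw [d1, abs_mul, abs_of_pos (hc0 n)]
      exact mul_le_mul_of_nonneg_left (hM1 i _) (hc0 n).le
    · have hj : ContDiff ℝ ∞ fun x => partialDeriv j χ (c n • x) :=
        (contDiff_partialDeriv hχ j).comp (contDiff_const_smul _)
      rw [d1, partialDeriv_const_mul _ _ hj, partialDeriv_comp_smul, abs_mul, abs_mul, abs_of_pos (hc0 n)]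
      refine mul_le_mul_of_nonneg_left ?_ (hc0 n).le
      -- Second derivatives carry a factor `c n ^ 2`, and `c n ≤ 1` absorbs one factor.
      exact (mul_le_of_le_one_left (abs_nonneg _) (hc1 n)).trans (hM2 i j _)
  have hlim : Tendsto (fun n => ∫ x, g n x ∂(ν : Measure (Space d))) atTop (𝓝 1) := by
    have : Tendsto (fun n => ∫ x, g n x ∂(ν : Measure (Space d))) atTop
        (𝓝 (∫ _, (1 : ℝ) ∂(ν : Measure (Space d)))) := by
      refine tendsto_integral_of_dominated_convergence (fun _ => 1)
        (fun n => (g_int n ν).aestronglyMeasurable) (integrable_const _) (fun n => ?_) ?_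
      · filter_upwards with x
        rw [Real.norm_of_nonneg (g_nonneg n x)]
        exact g_le n x
      · filter_upwards with x
        have h0 : Tendsto (fun n => c n • x) atTop (𝓝 0) := by
          simpa using hclim.smul_const x
        have := (hχ.continuous.tendsto 0).comp h0
        rwa [χ.one_of_mem_closedBall (Metric.mem_closedBall_self zero_le_one)] at this
    simpa using this
  -- A bound for the mass outside the ball of radius `2 / c n`: the initial defect plus the largest
  -- possible change up to time `T`.
  let u : ℕ → ℝ := fun n => (1 - ∫ x, g n x ∂(ν : Measure (Space d))) + C * (c n * M) * T
  have hu : Tendsto (fun n => (u n).toNNReal) atTop (𝓝 0) := by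
    have : Tendsto u atTop (𝓝 ((1 - 1) + C * (0 * M) * T)) :=
      (hlim.const_sub 1).add (((hclim.mul_const M).const_mul C).mul_const T)
    have h2 := (continuous_real_toNNReal.tendsto _).comp this
    simpa [Function.comp_def] using h2
  refine ⟨_, isCompact_setOfPred_probabilityMeasure_mass_eq_compl_isCompact_le hu
    (fun n => isCompact_closedBall (0 : Space d) (2 / c n)) (Or.inl inferInstance), ?_⟩
  intro μ hμ t ht n
  have h0T : (0 : ℝ) ≤ T := hs.1.trans hs.2
  have hinc : |(∫ x, g n x ∂(μ t : Measure (Space d))) - ∫ x, g n x ∂(ν : Measure (Space d))|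
      ≤ C * (c n * M) * T := by
    rw [hμ.equation (g n) (g_smooth n) (g_cpt n) t ht, ← Real.norm_eq_abs]
    refine (intervalIntegral.norm_integral_le_of_norm_le_const (C := C * (c n * M))
      fun r hr => ?_).trans ?_
    · rw [uIoc_of_le ht.1] at hr
      exact abs_integral_generator_le
        (g_gen n r ⟨hs.1.trans hr.1.le, hr.2.trans ht.2⟩) _
    · have := hc0 n
      rw [abs_of_nonneg (by linarith [ht.1])]
      exact mul_le_mul_of_nonneg_left (by linarith [hs.1, ht.2]) (by positivity)
  have hmass : ∫ x, g n x ∂(μ t : Measure (Space d))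
      ≤ (μ t : Measure (Space d)).real (Metric.closedBall (0 : Space d) (2 / c n)) := by
    rw [← integral_indicator_one Metric.isClosed_closedBall.measurableSet]
    refine integral_mono (g_int n _)
      ((integrable_const (1 : ℝ)).indicator Metric.isClosed_closedBall.measurableSet) fun x => ?_
    by_cases hx : x ∈ Metric.closedBall (0 : Space d) (2 / c n)
    · rw [indicator_of_mem hx]; exact g_le n x
    · rw [indicator_of_notMem hx, g_supp n x hx]
  refine NNReal.coe_le_coe.1 ?_
  rw [← ProbabilityMeasure.measureReal_eq_coe_coeFn,
    probReal_compl_eq_one_sub Metric.isClosed_closedBall.measurableSet]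
  refine le_trans ?_ (Real.le_coe_toNNReal _)
  have := (abs_le.1 hinc).1
  simp only [u]
  linarith

end Solutions

end FPK

/-! ### Compactness of the solution set. -/

/-- A sequence of functions which are uniformly Lipschitz on a set converges pointwise there as soon
as it converges along a dense sequence of the set. -/
theorem tendsto_of_lipschitz_of_denseRange {S : Set ℝ} {q : ℕ → S} (hq : DenseRange q)
    {φ : ℕ → ℝ → ℝ} {ψ : ℝ → ℝ} {M : ℝ} (hM : 0 ≤ M)
    (hφ : ∀ k, ∀ r ∈ S, ∀ t ∈ S, |φ k t - φ k r| ≤ M * |t - r|)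
    (hψ : ∀ r ∈ S, ∀ t ∈ S, |ψ t - ψ r| ≤ M * |t - r|)
    (h : ∀ n, Tendsto (fun k => φ k (q n)) atTop (𝓝 (ψ (q n)))) {t : ℝ} (ht : t ∈ S) :
    Tendsto (fun k => φ k t) atTop (𝓝 (ψ t)) := by
  rw [Metric.tendsto_nhds]
  intro ε hε
  -- The `M + 1` keeps the denominator positive when `M = 0`.
  obtain ⟨n, hn⟩ := Metric.denseRange_iff.1 hq ⟨t, ht⟩ (ε / (3 * (M + 1))) (by positivity)
  rw [Subtype.dist_eq, Real.dist_eq] at hn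
  have hsmall : M * |t - q n| < ε / 3 := by
    calc M * |t - q n| ≤ (M + 1) * |t - q n| := by gcongr; linarith
      _ < (M + 1) * (ε / (3 * (M + 1))) := by gcongr
      _ = ε / 3 := by field_simp
  filter_upwards [Metric.tendsto_nhds.1 (h n) (ε / 3) (by positivity)] with k hk
  rw [Real.dist_eq] at hk ⊢
  have h1 := abs_lt.1 hk
  have h2 := abs_le.1 (hφ k (q n) (q n).2 t ht)
  have h3 := abs_le.1 (hψ (q n) (q n).2 t ht)
  rw [abs_lt]
  constructor <;> linarith

namespace FPK

section Compactness

variable {d : ℕ} {T : ℝ} {a : ℝ → Space d → Matrix (Fin d) (Fin d) ℝ}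
  {b : ℝ → Space d → Fin d → ℝ}

/-- The solutions started in `(s, ν)`, frozen at `ν` outside of `[s,T]`. -/
def frozenFP (T : ℝ) (a : ℝ → Space d → Matrix (Fin d) (Fin d) ℝ) (b : ℝ → Space d → Fin d → ℝ)
    (s : ℝ) (ν : ProbabilityMeasure (Space d)) : Set (ℝ → ProbabilityMeasure (Space d)) :=
  {μ | IsSolution T a b s ν μ ∧ ∀ t ∉ Icc s T, μ t = ν}

open Classical in
theorem piecewise_mem_frozenFP {s : ℝ} (hs : s ≤ T) {ν : ProbabilityMeasure (Space d)}
    {μ : ℝ → ProbabilityMeasure (Space d)} (h : IsSolution T a b s ν μ) :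
    (Icc s T).piecewise μ (fun _ => ν) ∈ frozenFP T a b s ν :=
  ⟨h.congr hs (piecewise_eqOn _ _ _), fun _ ht => piecewise_eq_of_notMem _ _ _ ht⟩

/-- Pointwise conditions and the uniform Lipschitz bound pass directly to the closure. The time
integral needs dominated convergence, hence a sequence, whereas the product over all times is not
first countable; a sequence is therefore extracted along countably many dense times. -/
theorem AdmissibleCoefficients.isClosed_frozenFP (hab : AdmissibleCoefficients T a b)
    {s : ℝ} (hs : s ∈ Icc (0 : ℝ) T) (ν : ProbabilityMeasure (Space d)) :
    IsClosed (frozenFP T a b s ν) := by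
  obtain ⟨K, hK, hKmem⟩ := hab.exists_isCompact hs ν
  refine isClosed_of_closure_subset fun μ hμ => ?_
  have passes : ∀ {S : Set (ℝ → ProbabilityMeasure (Space d))}, IsClosed S →
      (∀ η ∈ frozenFP T a b s ν, η ∈ S) → μ ∈ S := fun hS h => closure_minimal h hS hμ
  have cont_int : ∀ {f : Space d → ℝ}, ContDiff ℝ ∞ f → HasCompactSupport f → ∀ t : ℝ,
      Continuous fun η : ℝ → ProbabilityMeasure (Space d) =>
        ∫ x, f x ∂(η t : Measure (Space d)) := fun hf hc t =>
    (ProbabilityMeasure.continuous_integral_of_hasCompactSupport hf.continuous hc).comp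
      (continuous_apply t)
  have hμK : ∀ t ∈ Icc s T, μ t ∈ K := fun t ht =>
    passes (hK.isClosed.preimage (continuous_apply t)) fun η hη => hKmem η hη.1 t ht
  have hinit : μ s = ν :=
    passes (isClosed_singleton.preimage (continuous_apply s)) fun η hη => hη.1.initial
  have hout : ∀ t ∉ Icc s T, μ t = ν := fun t ht =>
    passes (isClosed_singleton.preimage (continuous_apply t)) fun η hη => hη.2 t ht
  have hlip : ∀ {f : Space d → ℝ}, ContDiff ℝ ∞ f → HasCompactSupport f → ∃ M : ℝ, 0 ≤ M ∧
      (∀ η ∈ frozenFP T a b s ν, ∀ r ∈ Icc s T, ∀ t ∈ Icc s T,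
        |(∫ x, f x ∂(η t : Measure (Space d))) - ∫ x, f x ∂(η r : Measure (Space d))|
          ≤ M * |t - r|) ∧
      ∀ r ∈ Icc s T, ∀ t ∈ Icc s T,
        |(∫ x, f x ∂(μ t : Measure (Space d))) - ∫ x, f x ∂(μ r : Measure (Space d))|
          ≤ M * |t - r| := by
    intro f hf hc
    obtain ⟨M, hM, h⟩ := hab.exists_lipschitz hf hc
    refine ⟨M, hM, fun η hη => h s hs ν η hη.1, fun r hr t ht => ?_⟩
    exact passes (isClosed_le ((cont_int hf hc t).sub (cont_int hf hc r)).abs continuous_const)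
      fun η hη => h s hs ν η hη.1 r hr t ht
  have hcont : ContinuousOn μ (Icc s T) := by
    intro t ht
    refine hK.tendsto_probabilityMeasure_of_contDiff
      (eventually_mem_nhdsWithin.mono fun r hr => hμK r hr) fun f hf hc => ?_
    obtain ⟨M, -, -, h⟩ := hlip hf hc
    rw [tendsto_iff_dist_tendsto_zero]
    have hz : Tendsto (fun r => M * |r - t|) (𝓝[Icc s T] t) (𝓝 0) := by
      have : ContinuousAt (fun r : ℝ => M * |r - t|) t := by fun_prop
      simpa [ContinuousAt] using this.tendsto.mono_left nhdsWithin_le_nhds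
    refine squeeze_zero' (Eventually.of_forall fun _ => dist_nonneg) ?_ hz
    filter_upwards [eventually_mem_nhdsWithin] with r hr
    rw [Real.dist_eq]
    exact h t ht r hr
  have : Nonempty (Icc s T) := ⟨⟨s, left_mem_Icc.2 hs.2⟩⟩
  let q : ℕ → Icc s T := TopologicalSpace.denseSeq (Icc s T)
  let R : (ℝ → ProbabilityMeasure (Space d)) → ℕ → ProbabilityMeasure (Space d) :=
    fun η n => η (q n)
  have hR : Continuous R := continuous_pi fun n => continuous_apply _
  obtain ⟨y, hy, hylim⟩ := mem_closure_iff_seq_limit.1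
    (image_closure_subset_closure_image hR (mem_image_of_mem R hμ))
  choose η hη hηy using hy
  -- The common Lipschitz constant extends convergence from the dense times to all of `[s,T]`.
  have hηlim : ∀ t ∈ Icc s T, Tendsto (fun k => η k t) atTop (𝓝 (μ t)) := by
    intro t ht
    refine hK.tendsto_probabilityMeasure_of_contDiff
      (Eventually.of_forall fun k => hKmem _ (hη k).1 t ht) fun f hf hc => ?_
    obtain ⟨M, hM, h1, h2⟩ := hlip hf hc
    refine tendsto_of_lipschitz_of_denseRange
      (φ := fun k t => ∫ x, f x ∂(η k t : Measure (Space d)))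
      (ψ := fun t => ∫ x, f x ∂(μ t : Measure (Space d)))
      (TopologicalSpace.denseRange_denseSeq (Icc s T)) hM (fun k => h1 _ (hη k)) h2 (fun n => ?_) ht
    refine ((ProbabilityMeasure.continuous_integral_of_hasCompactSupport hf.continuous hc).tendsto
      _).comp ?_
    have := (tendsto_pi_nhds.1 hylim) n
    simpa only [← hηy] using this
  refine ⟨⟨fun B hB => measurable_apply_of_continuousOn hcont hB, hcont, hinit,
    fun f hf hc t ht => ?_⟩, hout⟩
  obtain ⟨M, hM, hbound⟩ := hab.exists_bound_generator hf hc
  have lhs : Tendsto (fun k => (∫ x, f x ∂(η k t : Measure (Space d))) -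
      ∫ x, f x ∂(ν : Measure (Space d))) atTop
      (𝓝 ((∫ x, f x ∂(μ t : Measure (Space d))) - ∫ x, f x ∂(ν : Measure (Space d)))) :=
    (((ProbabilityMeasure.continuous_integral_of_hasCompactSupport hf.continuous hc).tendsto
      _).comp (hηlim t ht)).sub_const _
  have hsub : ∀ u ∈ uIoc s t, u ∈ Icc s T := fun u hu =>
    uIcc_subset_Icc (left_mem_Icc.2 hs.2) ht (uIoc_subset_uIcc hu)
  have rhs : Tendsto (fun k => ∫ u in s..t, ∫ x, generator a b u f x ∂(η k u : Measure (Space d)))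
      atTop (𝓝 (∫ u in s..t, ∫ x, generator a b u f x ∂(μ u : Measure (Space d)))) := by
    refine intervalIntegral.tendsto_integral_filter_of_dominated_convergence (fun _ => M)
      (Eventually.of_forall fun k => ?_) (Eventually.of_forall fun k => ?_)
      intervalIntegrable_const ?_
    · exact ((hab.integrableOn_integral_generator hs (hη k).1.narrowly_continuous hf hc).mono_set
        hsub).aestronglyMeasurable
    · refine Eventually.of_forall fun u hu => ?_
      have hu' := hsub u hu
      exact abs_integral_generator_le (hbound u ⟨hs.1.trans hu'.1, hu'.2⟩) _
    · refine Eventually.of_forall fun u hu => ?_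
      have hu' := hsub u hu
      have hu0 : u ∈ Icc (0 : ℝ) T := ⟨hs.1.trans hu'.1, hu'.2⟩
      exact ((ProbabilityMeasure.continuous_integral_boundedContinuousFunction
        (BoundedContinuousFunction.ofNormedAddCommGroup _ (hab.continuous_generator hf hu0) M
          (hbound u hu0))).tendsto _).comp (hηlim u hu')
  refine tendsto_nhds_unique lhs (rhs.congr fun k => ?_)
  exact ((hη k).1.equation f hf hc t ht).symm

/-- Tychonoff's theorem; freezing confines the coordinates outside `[s,T]` to `{ν}`. -/
theorem AdmissibleCoefficients.isCompact_frozenFP (hab : AdmissibleCoefficients T a b)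
    {s : ℝ} (hs : s ∈ Icc (0 : ℝ) T) (ν : ProbabilityMeasure (Space d)) :
    IsCompact (frozenFP T a b s ν) := by
  obtain ⟨K, hK, hKmem⟩ := hab.exists_isCompact hs ν
  refine (isCompact_univ_pi (s := fun _ : ℝ => K ∪ {ν}) fun _ =>
    hK.union isCompact_singleton).of_isClosed_subset (hab.isClosed_frozenFP hs ν)
    fun μ hμ t _ => ?_
  by_cases ht : t ∈ Icc s T
  · exact Or.inl (hKmem μ hμ.1 t ht)
  · exact Or.inr (hμ.2 t ht)

end Compactness

/-! ### Observables and the selection. -/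

/-- A test function evaluated against a curve of measures at a fixed time. -/
structure Observable (d : ℕ) where
  time : ℝ
  test : Space d → ℝ
  contDiff : ContDiff ℝ ∞ test
  hasCompactSupport : HasCompactSupport test

/-- The value of an observable on a curve. -/
noncomputable def Observable.eval {d : ℕ} (i : Observable d)
    (μ : ℝ → ProbabilityMeasure (Space d)) : ℝ :=
  ∫ x, i.test x ∂(μ i.time : Measure (Space d))

theorem Observable.continuous_eval {d : ℕ} (i : Observable d) : Continuous i.eval :=
  (ProbabilityMeasure.continuous_integral_of_hasCompactSupport i.contDiff.continuous
    i.hasCompactSupport).comp (continuous_apply i.time)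

theorem Observable.eval_congr {d : ℕ} (i : Observable d) {μ η : ℝ → ProbabilityMeasure (Space d)}
    (h : μ i.time = η i.time) : i.eval μ = i.eval η := by
  unfold Observable.eval
  rw [h]

/-- Observables separate curves. -/
theorem Observable.exists_eval_ne {d : ℕ} {μ η : ℝ → ProbabilityMeasure (Space d)} (h : μ ≠ η) :
    ∃ i : Observable d, i.eval μ ≠ i.eval η := by
  contrapose! h
  ext1 t
  suffices (μ t : Measure (Space d)) = η t from Subtype.ext this
  exact Measure.ext_of_integral_contDiff fun f hf hc => h ⟨t, f, hf, hc⟩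

end FPK

theorem theorem3p2 (d : ℕ) (T : ℝ) (hT : 0 < T)
    (a : ℝ → FPK.Space d → Matrix (Fin d) (Fin d) ℝ) (b : ℝ → FPK.Space d → Fin d → ℝ)
    (hab : FPK.AdmissibleCoefficients T a b)
    (hne : ∀ s ∈ Icc (0 : ℝ) T, ∀ ν : ProbabilityMeasure (FPK.Space d),
      (FPK.FP T a b s ν).Nonempty) :
    ∃ μ : ℝ → ProbabilityMeasure (FPK.Space d) → ℝ → ProbabilityMeasure (FPK.Space d),
      (∀ s ∈ Icc (0 : ℝ) T, ∀ ν : ProbabilityMeasure (FPK.Space d),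
        μ s ν ∈ FPK.FP T a b s ν) ∧
      (∀ s r t : ℝ, 0 ≤ s → s ≤ r → r ≤ t → t ≤ T → ∀ ν : ProbabilityMeasure (FPK.Space d),
        μ s ν t = μ r (μ s ν r) t) := by
  classical
  -- An arbitrary well-order suffices, with no relation to the order of times; it must only be the
  -- same for all `(s, ν)`.
  obtain ⟨_, _⟩ := exists_wellFoundedLT (FPK.Observable d)
  have hex : ∀ (s : ℝ) (ν : ProbabilityMeasure (FPK.Space d)),
      ∃ μ : ℝ → ProbabilityMeasure (FPK.Space d), s ∈ Icc (0 : ℝ) T →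
        μ ∈ FPK.frozenFP T a b s ν ∧ ∀ η ∈ FPK.frozenFP T a b s ν, ∀ i : FPK.Observable d,
          (∀ j < i, j.eval η = j.eval μ) → i.eval η ≤ i.eval μ := by
    intro s ν
    by_cases hs : s ∈ Icc (0 : ℝ) T
    · obtain ⟨η, hη⟩ := hne s hs ν
      obtain ⟨μ, hμ, hmax⟩ := (hab.isCompact_frozenFP hs ν).exists_lexMax
        ⟨_, FPK.piecewise_mem_frozenFP hs.2 hη⟩ (fun i : FPK.Observable d => i.eval)
        fun i => i.continuous_eval
      exact ⟨μ, fun _ => ⟨hμ, hmax⟩⟩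
    · exact ⟨fun _ => ν, fun h => absurd h hs⟩
  choose μ hμ using hex
  refine ⟨μ, fun s hs ν => (hμ s ν hs).1.1, fun s r t hs0 hsr hrt htT ν => ?_⟩
  have hs : s ∈ Icc (0 : ℝ) T := ⟨hs0, hsr.trans (hrt.trans htT)⟩
  have hr : r ∈ Icc s T := ⟨hsr, hrt.trans htT⟩
  have hr0 : r ∈ Icc (0 : ℝ) T := ⟨hs0.trans hsr, hr.2⟩
  obtain ⟨hμsol, hμmax⟩ := hμ s ν hs
  obtain ⟨hηsol, hηmax⟩ := hμ r (μ s ν r) hr0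
  set η := μ r (μ s ν r)
  set η' := (Icc r T).piecewise (μ s ν) fun _ => μ s ν r with hη'
  have hη'sol : η' ∈ FPK.frozenFP T a b r (μ s ν r) :=
    FPK.piecewise_mem_frozenFP hr.2 (hμsol.1.restrict hab hs hr)
  suffices η' = η by
    rw [← this]
    exact (piecewise_eq_of_mem _ _ _ (show t ∈ Icc r T from ⟨hrt, htT⟩)).symm
  by_contra hne'
  -- At the first observable separating the two curves, maximality of `η` forces a strict
  -- inequality.
  obtain ⟨i, hi, hmin⟩ := wellFounded_lt.has_min {i : FPK.Observable d | i.eval η' ≠ i.eval η}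
    (FPK.Observable.exists_eval_ne hne')
  have hlt : ∀ j < i, j.eval η' = j.eval η := fun j hj => by
    by_contra h
    exact hmin j h hj
  have hi_lt : i.eval η' < i.eval η := lt_of_le_of_ne (hηmax η' hη'sol i hlt) hi
  have hitime : i.time ∈ Icc r T := by
    by_contra h
    exact hi (i.eval_congr ((hη'sol.2 _ h).trans (hηsol.2 _ h).symm))
  -- The competitor follows `μ s ν` up to `r` and `η` afterwards. It ties with `μ s ν` on every
  -- observable below `i` and beats it at `i`.
  set ρ := (Icc r T).piecewise η (μ s ν) with hρ
  have hρμ : EqOn ρ (μ s ν) (Icc s r) := by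
    intro u hu
    rcases hu.2.lt_or_eq with h | rfl
    · exact piecewise_eq_of_notMem _ _ _ fun h' => (h'.1.trans_lt h).false
    · exact (piecewise_eq_of_mem _ _ _ (left_mem_Icc.2 hr.2)).trans hηsol.1.initial
  have hρsol : ρ ∈ FPK.frozenFP T a b s ν := by
    refine ⟨hμsol.1.concat hab hs hr hηsol.1 hρμ (piecewise_eqOn _ _ _), fun u hu => ?_⟩
    rw [hρ, piecewise_eq_of_notMem _ _ _ fun h => hu ⟨hsr.trans h.1, h.2⟩]
    exact hμsol.2 u hu
  have hη'μ : ∀ u ∈ Icc r T, η' u = μ s ν u := piecewise_eqOn _ _ _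
  have hρη : ∀ u ∈ Icc r T, ρ u = η u := piecewise_eqOn _ _ _
  have hle := hμmax ρ hρsol i fun j hj => by
    by_cases h : j.time ∈ Icc r T
    · rw [j.eval_congr (hρη _ h), ← hlt j hj, j.eval_congr (hη'μ _ h)]
    · exact j.eval_congr (piecewise_eq_of_notMem _ _ _ h)
  rw [i.eval_congr (hρη _ hitime), ← i.eval_congr (hη'μ _ hitime)] at hle
  exact hle.not_gt hi_lt
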